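/- Let $q$ be a prime power, $1\le \ell\le m$ integers, and let $G(\ell,m)$ be the set of $\ell$-dimensional subspaces of $\mathbb F_q^m$. Let $I(\ell,m)$ be the set of tuples $\alpha=(\alpha_1<\dots<\alpha_\ell)$ with entries in $\{1,\dots,m\}$, ordered componentwise. For each $W\in G(\ell,m)$ fix an arbitrary $\ell\times m$ matrix $M_W$ with row space $W$, and let $\det_\alpha(M_W)$ be its minor on the columns $\alpha$. The Grassmann code $C(\ell,m)\subseteq\mathbb F_q^{G(\ell,m)}$ is spanned by the vectors $(\det_\alpha(M_W))_{W}$, $\alpha\in I(\ell,m)$. For $S\subseteq I(\ell,m)$ downward closed put $\Omega_\alpha=\{W : \det_\beta(M_W)=0 \text{ for all } \beta\not\le\alpha\}$ and $\Omega_S=\bigcup_{\alpha\in S}\Omega_\alpha$, and let the Schubert union code $C_S(\ell,m)\subseteq \mathbb F_q^{\Omega_S}$ be the projection of $C(\ell,m)$ on the coordinates in $\Omega_S$. A line of $G(\ell,m)$ is a set $\{V\in G(\ell,m) : Z\subseteq V\subseteq Z'\}$ with $Z\subseteq Z'$ subspaces of $\mathbb F_q^m$ of dimensions $\ell-1$ and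 $\ell+1$. Let $\Gamma_{\Omega_S}$ be the bipartite graph whose vertex classes are the points of $\Omega_S$ and the lines contained in $\Omega_S$, with edges given by incidence. Let $G$ be a bipartite graph with finite vertex classes $V_1,V_2$ in which every $u\in V_2$ has exactly $n'$ neighbors, $N(u)\subseteq V_1$ being the set of these, and let $C'\subseteq\mathbb F_q^{\mathcal N'}$ be a linear code with $\#\mathcal N'=n'$. A linear code $C\subseteq\mathbb F_q^{V_1}$ is a Tanner code $(G,C')$ if for each $u\in V_2$ there are a code $C'_u\subseteq\mathbb F_q^{\mathcal N'}$ (monomially) equivalent to $C'$ and a bijection $\phi_u:N(u)\to\mathcal N'$ that carries the projection $C^{N(u)}$ into $C'_u$. For given $\phi=(\phi_u)$ and $\mathcal C=(C'_u)$, the maximal Tanner code $(G,C')_{\phi,\mathcal C}$ is the dual of the span of the codes $D_u$, $u\in V_2$, where $D_u$ consists of the vectors supported on $N(u)$ whose projection on $N(u)$ lies in $\phi_u^{-1}(C'_u)^\perp$. **Theorem.** Let $S$ be a downward closed subset of $I(\ell,m)$. 1. The component code $C(1,2)$ is equivalent to the doubly extended Reed–Solomon code of dimension $2$ over $\mathbb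 F_q$; it is a $[q+1,2,q]$ code. 2. $C_S(\ell,m)$ is a Tanner code $(\Gamma_{\Omega_S},C(1,2))$. 3. If $C$ is any Tanner code $(\Gamma_{\Omega_S},C(1,2))$ with $C_S(\ell,m)\subseteq C$, then $C_S(\ell,m)=C$. 4. Whenever $\phi=(\phi_u)$ and $\mathcal C=(C'_u)$ are bijections and codes for which $C_S(\ell,m)$ is a Tanner code as in 2, one has $C_S(\ell,m)=(\Gamma_{\Omega_S},C(1,2))_{\phi,\mathcal C}$. -/

import Mathlib

namespace TannerSchubert

/-! ### Linear codes

A code in `F ^ A` is a linear subspace of the space of functions `A → F`. -/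

section Codes

variable {F : Type*} [Field F]

/-- The projection `C ^ B` of a code `C` on a set `B` of coordinates. -/
def proj {A : Type*} (C : Submodule F (A → F)) (B : Set A) : Submodule F (B → F) :=
  C.map (LinearMap.funLeft F F (Subtype.val : B → A))

/-- The image of a code under a bijection of the coordinate sets. -/
def transport {B B' : Type*} (φ : B ≃ B') (C : Submodule F (B → F)) :
    Submodule F (B' → F) :=
  C.map (LinearMap.funLeft F F φ.symm)

/-- Equivalence of linear codes (monomial equivalence): one code is obtained from the other by a
bijection of the coordinates followed by multiplying each coordinate by a nonzero scalar. -/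
def CodeEquiv {A A' : Type*} (C : Submodule F (A → F)) (C' : Submodule F (A' → F)) : Prop :=
  ∃ (σ : A ≃ A') (a : A' → Fˣ),
    ∀ c : A → F, c ∈ C ↔ (fun j => (a j : F) * c (σ.symm j)) ∈ C'

/-- The dual code for the standard bilinear form (the coordinate set is finite). -/
def dualCode {A : Type*} [Finite A] (C : Submodule F (A → F)) : Submodule F (A → F) where
  carrier := {d | ∀ c ∈ C, ∑ᶠ i, c i * d i = 0}
  zero_mem' := by intro c _; simp
  add_mem' := by
    intro d e hd he c hc
    have h : ∀ i, c i * (d + e) i = c i * d i + c i * e i := fun i => mul_add _ _ _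
    simp only [h]
    rw [finsum_add_distrib (Set.toFinite _) (Set.toFinite _), hd c hc, he c hc, add_zero]
  smul_mem' := by
    intro t d hd c hc
    have h : ∀ i, c i * (t • d) i = t * (c i * d i) := fun i => by
      simp only [Pi.smul_apply, smul_eq_mul]; ring
    simp only [h]
    rw [← mul_finsum, hd c hc, mul_zero]

/-- `C` has minimum distance `d`: the least weight of a nonzero codeword is `d`. -/
def HasMinDist {A : Type*} (C : Submodule F (A → F)) (d : ℕ) : Prop :=
  IsLeast {w : ℕ | ∃ c ∈ C, c ≠ 0 ∧ (Function.support c).ncard = w} d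

/-- The doubly extended Reed-Solomon code of dimension `k`. Its coordinates are the points of the
projective line `F ∪ {∞}`; the codeword of a polynomial `f` of degree less than `k` has entry
`f x` at `x ∈ F`, and at `∞` the coefficient of degree `k - 1`. -/
noncomputable def doublyExtendedRS (F : Type*) [Field F] (k : ℕ) :
    Submodule F (Option F → F) :=
  (Polynomial.degreeLT F k).map
    (LinearMap.pi fun p : Option F =>
      match p with
      | some x => Polynomial.leval x
      | none => Polynomial.lcoeff F (k - 1))

end Codes

/-! ### Bipartite graphs and Tanner codes -/

/-- A bipartite graph with vertex classes `V₁` and `V₂`. -/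
structure BipartiteGraph (V₁ V₂ : Type*) where
  /-- the set of edges -/
  edges : Set (V₁ × V₂)

namespace BipartiteGraph

variable {V₁ V₂ : Type*} (G : BipartiteGraph V₁ V₂)

/-- The neighborhood in `V₁` of a vertex of `V₂`. -/
def nbhd (u : V₂) : Set V₁ := {v | (v, u) ∈ G.edges}

/-- Every vertex of `V₂` has exactly `n` neighbors. -/
def IsRightRegular (n : ℕ) : Prop := ∀ u : V₂, (G.nbhd u).Finite ∧ (G.nbhd u).ncard = n

end BipartiteGraph

section Tanner

variable {F : Type*} [Field F] {V₁ V₂ N : Type*}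

/-- `C` is a Tanner code on the graph `G` with component code `C'`, for the given bijections `φ u`
from the neighborhoods onto the coordinate set of `C'` and the given codes `D u` equivalent
to `C'`. -/
def IsTannerCodeFor (G : BipartiteGraph V₁ V₂) (C' : Submodule F (N → F))
    (φ : ∀ u : V₂, G.nbhd u ≃ N) (D : V₂ → Submodule F (N → F))
    (C : Submodule F (V₁ → F)) : Prop :=
  ∀ u : V₂, CodeEquiv (D u) C' ∧ transport (φ u) (proj C (G.nbhd u)) ≤ D u

/-- `C` is a Tanner code with component code `C'` and associated bipartite graph `G`. -/
def IsTannerCode (G : BipartiteGraph V₁ V₂) (C' : Submodule F (N → F))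
    (C : Submodule F (V₁ → F)) : Prop :=
  G.IsRightRegular (Nat.card N) ∧
    ∃ (φ : ∀ u : V₂, G.nbhd u ≃ N) (D : V₂ → Submodule F (N → F)), IsTannerCodeFor G C' φ D C

/-- The code of the parity checks imposed at `u`: the vectors supported on the neighborhood of `u`
whose projection there lies in the dual of the code `D u` pulled back along `φ u`. -/
def localChecks [Finite V₁] (G : BipartiteGraph V₁ V₂)
    (φ : ∀ u : V₂, G.nbhd u ≃ N) (D : V₂ → Submodule F (N → F)) (u : V₂) :
    Submodule F (V₁ → F) where
  carrier := {d | Function.support d ⊆ G.nbhd u ∧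
    LinearMap.funLeft F F (Subtype.val : G.nbhd u → V₁) d ∈
      dualCode (transport (φ u).symm (D u))}
  zero_mem' := ⟨by simp, by simp⟩
  add_mem' := by
    rintro d e ⟨hd, hd'⟩ ⟨he, he'⟩
    refine ⟨(Function.support_add d e).trans (Set.union_subset hd he), ?_⟩
    rw [map_add]
    exact Submodule.add_mem _ hd' he'
  smul_mem' := by
    rintro t d ⟨hd, hd'⟩
    refine ⟨(Function.support_const_smul_subset t d).trans hd, ?_⟩
    rw [map_smul]
    exact Submodule.smul_mem _ t hd'

/-- The maximal Tanner code for the bijections `φ` and the codes `D`: the dual of the span of all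
the local parity checks. -/
def maximalTannerCode [Finite V₁] (G : BipartiteGraph V₁ V₂)
    (φ : ∀ u : V₂, G.nbhd u ≃ N) (D : V₂ → Submodule F (N → F)) : Submodule F (V₁ → F) :=
  dualCode (⨆ u : V₂, localChecks G φ D u)

end Tanner

/-! ### The Grassmannian, Schubert unions and their codes -/

/-- The Grassmannian: the `ℓ`-dimensional subspaces of `F ^ m`. -/
abbrev Grassmannian (F : Type*) [Field F] (ℓ m : ℕ) : Type _ :=
  {W : Submodule F (Fin m → F) // Module.finrank F W = ℓ}

/-- The index set `I(ℓ, m)` of strictly increasing `ℓ`-tuples in an `m`-element chain (here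
`0, …, m - 1`). The order it inherits is the componentwise (Bruhat) order, so downward closed
subsets are the sets satisfying `IsLowerSet`. -/
abbrev Idx (ℓ m : ℕ) : Type := {α : Fin ℓ → Fin m // StrictMono α}

section Grassmann

variable {F : Type*} [Field F] {ℓ m : ℕ}

variable (F ℓ m) in
/-- A choice, for each `W` in the Grassmannian, of an `ℓ × m` matrix with row space `W`. -/
structure RepMatrices where
  /-- the chosen matrix -/
  mat : Grassmannian F ℓ m → Matrix (Fin ℓ) (Fin m) F
  rowSpace_mat : ∀ W, Submodule.span F (Set.range (mat W).row) = W.1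

instance : Nonempty (RepMatrices F ℓ m) := by
  refine ⟨⟨fun W => Matrix.of fun i =>
    (Module.finBasisOfFinrankEq F W.1 W.2 i : Fin m → F), fun W => ?_⟩⟩
  have h := (Module.finBasisOfFinrankEq F W.1 W.2).span_eq
  have h2 := congrArg (Submodule.map W.1.subtype) h
  rw [Submodule.map_span, Submodule.map_subtype_top, ← Set.range_comp] at h2
  exact h2

/-- The maximal minor of an `ℓ × m` matrix on the columns indexed by `α`. -/
def minor (α : Idx ℓ m) (A : Matrix (Fin ℓ) (Fin m) F) : F := (A.submatrix id α.1).det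

/-- The Grassmann code: the row space of the matrix with entry `det_α (M_W)` in row `α` and
column `W`. -/
def grassmannCode (M : RepMatrices F ℓ m) : Submodule F (Grassmannian F ℓ m → F) :=
  Submodule.span F (Set.range fun α : Idx ℓ m => fun W => minor α (M.mat W))

/-- The Schubert variety `Ω_α`. -/
def schubertVariety (M : RepMatrices F ℓ m) (α : Idx ℓ m) : Set (Grassmannian F ℓ m) :=
  {W | ∀ β : Idx ℓ m, ¬ β ≤ α → minor β (M.mat W) = 0}

/-- The Schubert union `Ω_S`. -/
def schubertUnion (M : RepMatrices F ℓ m) (S : Set (Idx ℓ m)) : Set (Grassmannian F ℓ m) :=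
  ⋃ α ∈ S, schubertVariety M α

/-- The Schubert union code: the projection of the Grassmann code on `Ω_S`. -/
def schubertUnionCode (M : RepMatrices F ℓ m) (S : Set (Idx ℓ m)) :
    Submodule F (schubertUnion M S → F) :=
  proj (grassmannCode M) (schubertUnion M S)

/-- A line of the Grassmannian: all `V` with `Z ≤ V ≤ Z'`, for subspaces `Z ≤ Z'` of dimensions
`ℓ - 1` and `ℓ + 1`. -/
def IsLine (L : Set (Grassmannian F ℓ m)) : Prop :=
  ∃ Z Z' : Submodule F (Fin m → F), Module.finrank F Z + 1 = ℓ ∧ Module.finrank F Z' = ℓ + 1 ∧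
    Z ≤ Z' ∧ L = {V | Z ≤ V.1 ∧ V.1 ≤ Z'}

/-- The set of lines of the Grassmannian that are contained in `X`. -/
def linesIn (X : Set (Grassmannian F ℓ m)) : Set (Set (Grassmannian F ℓ m)) :=
  {L | IsLine L ∧ L ⊆ X}

/-- The point-line incidence graph of a set `X` of points of the Grassmannian. -/
def incidenceGraph (X : Set (Grassmannian F ℓ m)) : BipartiteGraph X (linesIn X) where
  edges := {e | e.1.1 ∈ e.2.1}

end Grassmann

end TannerSchubert

open TannerSchubert

namespace TannerSchubert

/-! ### Minors and row spaces -/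

section Minors

variable {F : Type*} [Field F] {ℓ m : ℕ}

/-! On a line of the Grassmannian, a point is `Z + ⟨x⟩` with `Z` fixed, and each minor is, up to a
common nonzero scalar, linear in `x`. So Grassmann codewords restrict to linear forms on a
projective line, and every linear form occurs (`IsLine.exists_equiv`). The restricted code is thus
already a full copy of `C(1,2)`, and any `D u` presenting the Schubert union code equals its
projection by dimension (`transport_proj_eq_of_isTannerCodeFor`).

Both maximality claims then reduce to a local-to-global statement, `mem_schubertUnionCode_of_proj`:
a word that is a codeword on every line is a codeword. Subtract the combination of minors with the
same values at the coordinate subspaces, so that the word vanishes at all of them. A linear form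
vanishing at two points of a projective line vanishes on the line. A point of `Ω_α` is the row space
of a matrix whose row `i` vanishes beyond column `α i`; writing the rows, one at a time, as sums of
multiples of unit vectors reaches it from coordinate subspaces along lines that stay inside `Ω_α`
(`eq_zero_on_schubertVariety`). For the maximal Tanner code, biduality recovers the local codes from
their checks. -/

theorem minor_mul (α : Idx ℓ m) (A : Matrix (Fin ℓ) (Fin ℓ) F) (N : Matrix (Fin ℓ) (Fin m) F) :
    minor α (A * N) = A.det * minor α N := by
  unfold minor
  rw [← Matrix.det_mul, Matrix.submatrix_mul A N id id α.1 Function.bijective_id,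
    Matrix.submatrix_id_id]

theorem exists_mul_of_row_mem_span {N N' : Matrix (Fin ℓ) (Fin m) F}
    (h : ∀ i, N' i ∈ Submodule.span F (Set.range N.row)) :
    ∃ A : Matrix (Fin ℓ) (Fin ℓ) F, N' = A * N := by
  choose A hA using fun i => (Submodule.mem_span_range_iff_exists_fun F).1 (h i)
  refine ⟨Matrix.of A, ?_⟩
  ext i j
  have := congrFun (hA i) j
  simp only [Finset.sum_apply, Pi.smul_apply, smul_eq_mul] at this
  rw [← this, Matrix.mul_apply]
  rfl

theorem linearIndependent_row_iff_finrank (N : Matrix (Fin ℓ) (Fin m) F) :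
    LinearIndependent F N.row ↔
      Module.finrank F (Submodule.span F (Set.range N.row)) = ℓ := by
  rw [linearIndependent_iff_card_eq_finrank_span, Fintype.card_fin, eq_comm]
  rfl

theorem linearIndependent_row_of_span_eq {N : Matrix (Fin ℓ) (Fin m) F}
    {W : Grassmannian F ℓ m} (h : Submodule.span F (Set.range N.row) = W.1) :
    LinearIndependent F N.row := by
  rw [linearIndependent_row_iff_finrank, h, W.2]

theorem exists_det_ne_zero_mul {N N' : Matrix (Fin ℓ) (Fin m) F}
    (hN' : LinearIndependent F N'.row)
    (h : Submodule.span F (Set.range N'.row) = Submodule.span F (Set.range N.row)) :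
    ∃ A : Matrix (Fin ℓ) (Fin ℓ) F, A.det ≠ 0 ∧ N' = A * N := by
  obtain ⟨A, hA⟩ := exists_mul_of_row_mem_span (N := N) (N' := N')
    fun i => h ▸ Submodule.subset_span ⟨i, rfl⟩
  obtain ⟨B, hB⟩ := exists_mul_of_row_mem_span (N := N') (N' := N)
    fun i => h ▸ Submodule.subset_span ⟨i, rfl⟩
  refine ⟨A, fun h0 => ?_, hA⟩
  obtain ⟨v, hv, hvA⟩ := Matrix.exists_vecMul_eq_zero_iff.2 h0
  apply hv
  have h1 : Matrix.vecMul v N' = 0 := by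
    rw [hA, ← Matrix.vecMul_vecMul, hvA, Matrix.zero_vecMul]
  have := Matrix.vecMul_injective_iff.2 hN'
  exact this (h1.trans (Matrix.zero_vecMul N').symm)

/-- A change of basis multiplies all minors by one determinant, so `t` does not depend on `α`. Any
convenient matrix may therefore replace the chosen one. -/
theorem exists_minor_mat_eq (M : RepMatrices F ℓ m) {W : Grassmannian F ℓ m}
    {N : Matrix (Fin ℓ) (Fin m) F} (h : Submodule.span F (Set.range N.row) = W.1) :
    ∃ t : F, t ≠ 0 ∧ ∀ α, minor α (M.mat W) = t * minor α N := by
  obtain ⟨A, hA, h'⟩ := exists_det_ne_zero_mul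
    (linearIndependent_row_of_span_eq (M.rowSpace_mat W)) ((M.rowSpace_mat W).trans h.symm)
  exact ⟨A.det, hA, fun α => by rw [h', minor_mul]⟩

theorem exists_sort {f : Fin ℓ → Fin m} (hf : Function.Injective f) :
    ∃ (γ : Idx ℓ m) (σ : Equiv.Perm (Fin ℓ)), f = γ.1 ∘ σ :=
  ⟨⟨f ∘ Tuple.sort f, (Tuple.monotone_sort f).strictMono_of_injective
    (hf.comp (Tuple.sort f).injective)⟩, (Tuple.sort f)⁻¹, by
      ext; simp⟩

theorem det_submatrix_comp_perm (N : Matrix (Fin ℓ) (Fin m) F) (γ : Idx ℓ m)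
    (σ : Equiv.Perm (Fin ℓ)) :
    (N.submatrix id (γ.1 ∘ σ)).det = (Equiv.Perm.sign σ : ℤ) * minor γ N := by
  unfold minor
  rw [← Matrix.det_permute']
  rfl

theorem exists_minor_ne_zero {N : Matrix (Fin ℓ) (Fin m) F} (hN : LinearIndependent F N.row) :
    ∃ α, minor α N ≠ 0 := by
  obtain ⟨κ, a, ha, hspan, hli⟩ := exists_linearIndependent' F N.col
  have hr : Module.finrank F (Submodule.span F (Set.range N.col)) = ℓ := by
    rw [← Matrix.rank_eq_finrank_span_cols, Matrix.rank_eq_finrank_span_row,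
      (linearIndependent_row_iff_finrank N).1 hN]
  have := Fintype.ofInjective a ha
  have hc : Fintype.card κ = ℓ := by
    rw [linearIndependent_iff_card_eq_finrank_span.1 hli, Set.finrank, hspan, hr]
  let e : Fin ℓ ≃ κ := (Fintype.equivFinOfCardEq hc).symm
  obtain ⟨γ, σ, hγ⟩ := exists_sort (ha.comp e.injective)
  refine ⟨γ, fun h0 => ?_⟩
  have h1 := det_submatrix_comp_perm N γ σ
  rw [h0, mul_zero, ← hγ] at h1
  have h2 : LinearIndependent F (N.submatrix id (a ∘ e)).col := hli.comp e e.injective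
  rw [Matrix.linearIndependent_cols_iff_isUnit, Matrix.isUnit_iff_isUnit_det, h1] at h2
  exact not_isUnit_zero h2

/-- Each point of the Grassmannian has a matrix in echelon form, normalised at a minor that does
not vanish. -/
theorem exists_echelon (N : Matrix (Fin ℓ) (Fin m) F) (hN : LinearIndependent F N.row) :
    ∃ (β : Idx ℓ m) (A : Matrix (Fin ℓ) (Fin ℓ) F), A.det ≠ 0 ∧ minor β N ≠ 0 ∧
      ∀ i k, β.1 i < k → (A * N) i k = 0 := by
  classical
  obtain ⟨α₀, h₀⟩ := exists_minor_ne_zero hN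
  -- The pivots are the columns of a nonzero minor with the largest index sum; the inverse of that
  -- block normalises it to the identity.
  obtain ⟨β, hβ, hmax⟩ := Finset.exists_max_image
    (Finset.univ.filter fun α : Idx ℓ m => minor α N ≠ 0) (fun α => ∑ i, (α.1 i : ℕ))
    ⟨α₀, by simpa using h₀⟩
  simp only [Finset.mem_filter, Finset.mem_univ, true_and] at hβ hmax
  have hu : IsUnit (N.submatrix id β.1).det := isUnit_iff_ne_zero.2 hβ
  let A := (N.submatrix id β.1)⁻¹
  have hA : A.det ≠ 0 := (Matrix.isUnit_nonsing_inv_det _ hu).ne_zero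
  have hAN : (A * N).submatrix id β.1 = 1 := by
    rw [← Matrix.submatrix_mul_equiv A N id (Equiv.refl _) β.1]
    exact Matrix.nonsing_inv_mul _ hu
  refine ⟨β, A, hA, hβ, fun i k hik => ?_⟩
  by_cases hk : ∃ j, β.1 j = k
  · obtain ⟨j, rfl⟩ := hk
    have := congrFun (congrFun hAN i) j
    simp only [Matrix.submatrix_apply, id] at this
    rw [this, Matrix.one_apply_ne]
    rintro rfl
    exact lt_irrefl _ hik
  · push Not at hk
    -- Exchanging pivot `β i` for the larger column `k` raises the index sum, so the new minor
    -- vanishes. The pivot block being the identity, that minor is, up to sign, the entry at `(i,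
    -- k)`.
    have hinj : Function.Injective (Function.update β.1 i k) := by
      intro a b hab
      by_cases ha : a = i <;> by_cases hb : b = i
      · rw [ha, hb]
      · subst ha
        rw [Function.update_self, Function.update_of_ne hb] at hab
        exact absurd hab.symm (hk b)
      · subst hb
        rw [Function.update_self, Function.update_of_ne ha] at hab
        exact absurd hab (hk a)
      · rw [Function.update_of_ne ha, Function.update_of_ne hb] at hab
        exact β.2.injective hab
    obtain ⟨γ, σ, hγ⟩ := exists_sort hinj
    have hsum : ∑ j, (β.1 j : ℕ) < ∑ j, (γ.1 j : ℕ) := by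
      have : ∑ j, (γ.1 j : ℕ) = ∑ j, ((Function.update β.1 i k j : Fin m) : ℕ) := by
        rw [hγ]
        exact (Equiv.sum_comp σ fun j => (γ.1 j : ℕ)).symm
      rw [this]
      refine Finset.sum_lt_sum (fun j _ => ?_) ⟨i, Finset.mem_univ _, ?_⟩
      · by_cases hj : j = i
        · subst hj
          rw [Function.update_self]
          exact hik.le
        · rw [Function.update_of_ne hj]
      · rw [Function.update_self]
        exact hik
    have h0 : minor γ N = 0 := by
      by_contra h
      exact absurd (hmax γ h) (not_le.2 hsum)
    have h1 := det_submatrix_comp_perm (A * N) γ σ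
    rw [minor_mul, h0, mul_zero, mul_zero, ← hγ] at h1
    have h2 : (A * N).submatrix id (Function.update β.1 i k) =
        Matrix.updateCol (1 : Matrix (Fin ℓ) (Fin ℓ) F) i (fun j => (A * N) j k) := by
      rw [← hAN]
      ext a b
      by_cases hb : b = i
      · subst hb
        simp
      · simp [hb]
    rw [h2, ← Matrix.cramer_apply, Matrix.cramer_one] at h1
    exact h1

/-- A matrix whose `i`-th row vanishes beyond column `α i` has no nonzero minor outside the
Bruhat interval below `α`. -/
theorem minor_eq_zero_of_not_le {α β : Idx ℓ m} {N : Matrix (Fin ℓ) (Fin m) F}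
    (hN : ∀ i k, α.1 i < k → N i k = 0) (h : ¬ β ≤ α) : minor β N = 0 := by
  have h' : ∃ i, α.1 i < β.1 i := by
    by_contra! h'
    exact h h'
  obtain ⟨i, hi⟩ := h'
  unfold minor
  rw [Matrix.det_apply]
  refine Finset.sum_eq_zero fun σ _ => ?_
  -- Pigeonhole: the preimage of `Iic i` under `σ` is too large for `Iio i`. The factor in row `σ j`
  -- and column `β j` lies beyond `α (σ j)`, so every term of the expansion is zero.
  have : ∃ j, σ j ≤ i ∧ i ≤ j := by
    by_contra! hc
    have hsub : (Finset.Iic i).image σ.symm ⊆ Finset.Iio i := by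
      intro j hj
      obtain ⟨a, ha, rfl⟩ := Finset.mem_image.1 hj
      exact Finset.mem_Iio.2 (hc _ (by simpa using ha))
    have := Finset.card_le_card hsub
    rw [Finset.card_image_of_injective _ σ.symm.injective, Fin.card_Iic, Fin.card_Iio] at this
    omega
  obtain ⟨j, hj, hij⟩ := this
  rw [Finset.prod_eq_zero (Finset.mem_univ j), smul_zero]
  exact hN _ _ ((α.2.monotone hj).trans_lt (hi.trans_le (β.2.monotone hij)))

theorem mem_schubertVariety_of_row {M : RepMatrices F ℓ m} {α : Idx ℓ m} {W : Grassmannian F ℓ m}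
    {N : Matrix (Fin ℓ) (Fin m) F} (h : Submodule.span F (Set.range N.row) = W.1)
    (hN : ∀ i k, α.1 i < k → N i k = 0) : W ∈ schubertVariety M α := by
  obtain ⟨t, _, ht⟩ := exists_minor_mat_eq M h
  intro β hβ
  rw [ht, minor_eq_zero_of_not_le hN hβ, mul_zero]

/-- The pivot minor `β` of the echelon form is nonzero, so membership forces `β ≤ α`, and rows
vanishing beyond `β i` vanish beyond `α i`. -/
theorem exists_row_of_mem_schubertVariety {M : RepMatrices F ℓ m} {α : Idx ℓ m}
    {W : Grassmannian F ℓ m} (hW : W ∈ schubertVariety M α) :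
    ∃ N : Matrix (Fin ℓ) (Fin m) F, Submodule.span F (Set.range N.row) = W.1 ∧
      ∀ i k, α.1 i < k → N i k = 0 := by
  have hli := linearIndependent_row_of_span_eq (M.rowSpace_mat W)
  obtain ⟨β, A, hA, hβ, hz⟩ := exists_echelon (M.mat W) hli
  have hle : β ≤ α := by
    by_contra h
    exact hβ (hW β h)
  refine ⟨A * M.mat W, ?_, fun i k hk => hz i k (lt_of_le_of_lt (hle i) hk)⟩
  have hli' : LinearIndependent F (A * M.mat W).row := by
    rw [← Matrix.vecMul_injective_iff] at hli ⊢
    intro v w hvw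
    simp only [← Matrix.vecMul_vecMul] at hvw
    exact Matrix.vecMul_injective_of_isUnit
      ((Matrix.isUnit_iff_isUnit_det A).2 (isUnit_iff_ne_zero.2 hA)) (hli hvw)
  refine Submodule.eq_of_le_of_finrank_eq ?_ ?_
  · rw [Submodule.span_le]
    rintro _ ⟨i, rfl⟩
    rw [← M.rowSpace_mat W]
    refine (Submodule.mem_span_range_iff_exists_fun F).2 ⟨A i, ?_⟩
    ext j
    simp [Matrix.mul_apply, Matrix.row]
  · rw [(linearIndependent_row_iff_finrank _).1 hli', W.2]

/-- The matrix of the coordinate subspace of an index. -/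
def coordMatrix (F : Type*) [Field F] (γ : Idx ℓ m) : Matrix (Fin ℓ) (Fin m) F :=
  Matrix.of fun i => Pi.single (γ.1 i) 1

theorem minor_coordMatrix_self (γ : Idx ℓ m) : minor γ (coordMatrix F γ) = 1 := by
  have h : (coordMatrix F γ).submatrix id γ.1 = 1 := by
    ext a b
    simp [coordMatrix, Pi.single_apply, Matrix.one_apply, γ.2.injective.eq_iff, eq_comm]
  rw [minor, h, Matrix.det_one]

/-- Distinct increasing tuples have distinct ranges of equal size, so `β` misses some `γ i` and row
`i` of the submatrix is zero. Coordinate subspaces are thus dual to the minors, which permits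
interpolation at them. -/
theorem minor_coordMatrix_of_ne {β γ : Idx ℓ m} (h : β ≠ γ) : minor β (coordMatrix F γ) = 0 := by
  have : ∃ i, ∀ j, β.1 j ≠ γ.1 i := by
    by_contra! hc
    apply h
    refine Subtype.ext ((StrictMono.range_inj β.2 γ.2).1 ?_)
    have hsub : Set.range γ.1 ⊆ Set.range β.1 := by
      rintro _ ⟨i, rfl⟩
      exact hc i
    refine (Set.eq_of_subset_of_ncard_le hsub ?_ (Set.toFinite _)).symm
    rw [← Set.image_univ, ← Set.image_univ, Set.ncard_image_of_injective _ β.2.injective,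
      Set.ncard_image_of_injective _ γ.2.injective]
  obtain ⟨i, hi⟩ := this
  exact Matrix.det_eq_zero_of_row_eq_zero i fun j => Pi.single_eq_of_ne (hi j) _

theorem linearIndependent_coordMatrix (γ : Idx ℓ m) :
    LinearIndependent F (coordMatrix F γ).row := by
  have := (Pi.linearIndependent_single_one (Fin m) F).comp γ.1 γ.2.injective
  exact this

end Minors

/-! ### Generation of Schubert varieties by coordinate subspaces -/

section Span

variable {F E : Type*} [Field F] [AddCommGroup E] [Module F E]

theorem sup_span_singleton_eq {Z : Submodule F E} {x y : E} {c : F} (hc : c ≠ 0)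
    (h : y - c • x ∈ Z) : Z ⊔ Submodule.span F {y} = Z ⊔ Submodule.span F {x} := by
  have hx : x ∈ Z ⊔ Submodule.span F {x} :=
    Submodule.mem_sup_right (Submodule.mem_span_singleton_self x)
  have hy : y ∈ Z ⊔ Submodule.span F {y} :=
    Submodule.mem_sup_right (Submodule.mem_span_singleton_self y)
  apply le_antisymm
  · refine sup_le le_sup_left ((Submodule.span_singleton_le_iff_mem _ _).2 ?_)
    have := Submodule.add_mem _ (Submodule.mem_sup_left h) (Submodule.smul_mem _ c hx)
    rwa [sub_add_cancel] at this
  · refine sup_le le_sup_left ((Submodule.span_singleton_le_iff_mem _ _).2 ?_)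
    have := Submodule.smul_mem _ c⁻¹ (Submodule.sub_mem _ hy (Submodule.mem_sup_left h))
    rwa [sub_sub_cancel, smul_smul, inv_mul_cancel₀ hc, one_smul] at this

theorem notMem_of_finrank_lt_sup {Z : Submodule F E} {x : E}
    (h : Module.finrank F Z < Module.finrank F (Z ⊔ Submodule.span F {x} : Submodule F E)) :
    x ∉ Z := by
  intro hx
  rw [sup_eq_left.2 ((Submodule.span_singleton_le_iff_mem _ _).2 hx)] at h
  exact lt_irrefl _ h

variable [FiniteDimensional F E]

theorem eq_sup_span_singleton {Z V : Submodule F E} {t : E} (hZV : Z ≤ V)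
    (hV : Module.finrank F Z + 1 = Module.finrank F V) (ht : t ∈ V) (htZ : t ∉ Z) :
    V = Z ⊔ Submodule.span F {t} := by
  symm
  refine Submodule.eq_of_le_of_finrank_eq
    (sup_le hZV ((Submodule.span_singleton_le_iff_mem _ _).2 ht)) ?_
  rw [Submodule.finrank_sup_span_singleton htZ, hV]

theorem exists_eq_sup_span_singleton {Z W V : Submodule F E} (hZV : Z ≤ V) (hVW : V ≤ Z ⊔ W)
    (hV : Module.finrank F Z + 1 = Module.finrank F V) :
    ∃ w ∈ W, w ∉ Z ∧ V = Z ⊔ Submodule.span F {w} := by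
  have hlt : Z < V := lt_of_le_of_ne hZV (by rintro rfl; omega)
  obtain ⟨t, htV, htZ⟩ := Set.exists_of_ssubset hlt
  obtain ⟨z, hz, w, hw, rfl⟩ := Submodule.mem_sup.1 (hVW htV)
  have hwZ : w ∉ Z := fun h => htZ (Z.add_mem hz h)
  have hwV : w ∈ V := by
    have := V.sub_mem htV (hZV hz)
    rwa [add_sub_cancel_left] at this
  exact ⟨w, hw, hwZ, eq_sup_span_singleton hZV hV hwV hwZ⟩

end Span

section Generation

variable {F : Type*} [Field F] {ℓ m : ℕ}

/-- The span of all rows but one. -/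
def spanOthers (N : Matrix (Fin ℓ) (Fin m) F) (i : Fin ℓ) : Submodule F (Fin m → F) :=
  Submodule.span F (N.row '' {i}ᶜ)

theorem span_updateRow (N : Matrix (Fin ℓ) (Fin m) F) (i : Fin ℓ) (x : Fin m → F) :
    Submodule.span F (Set.range (N.updateRow i x).row) =
      spanOthers N i ⊔ Submodule.span F {x} := by
  rw [spanOthers, ← Submodule.span_union]
  congr 1
  ext y
  constructor
  · rintro ⟨j, rfl⟩
    by_cases hj : j = i
    · right
      subst hj
      exact Matrix.updateRow_self
    · left
      exact ⟨j, hj, (Matrix.updateRow_ne hj).symm⟩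
  · rintro (⟨j, hj, rfl⟩ | rfl)
    · exact ⟨j, Matrix.updateRow_ne hj⟩
    · exact ⟨i, Matrix.updateRow_self⟩

theorem finrank_spanOthers_lt (N : Matrix (Fin ℓ) (Fin m) F) (i : Fin ℓ) :
    Module.finrank F (spanOthers N i) < ℓ := by
  classical
  have h : N.row '' {i}ᶜ = (((Finset.univ.erase i).image N.row : Finset (Fin m → F)) :
      Set (Fin m → F)) := by
    ext; simp
  unfold spanOthers
  rw [h]
  refine (finrank_span_finset_le_card _).trans_lt (Finset.card_image_le.trans_lt ?_)
  rw [Finset.card_erase_of_mem (Finset.mem_univ i), Finset.card_fin]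
  have := i.2
  omega

/-- A minor as a linear function of one row. -/
def rowMinor (N : Matrix (Fin ℓ) (Fin m) F) (i : Fin ℓ) (α : Idx ℓ m) :
    (Fin m → F) →ₗ[F] F where
  toFun x := minor α (N.updateRow i x)
  map_add' x y := by
    have h : ∀ z : Fin m → F, (N.updateRow i z).submatrix id α.1 =
        (N.submatrix id α.1).updateRow i (z ∘ α.1) := fun z => by
      ext a b
      by_cases ha : a = i
      · subst ha; simp
      · simp [ha]
    unfold minor
    rw [h, h, h, ← Matrix.det_updateRow_add]
    rfl
  map_smul' c x := by
    have h : ∀ z : Fin m → F, (N.updateRow i z).submatrix id α.1 =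
        (N.submatrix id α.1).updateRow i (z ∘ α.1) := fun z => by
      ext a b
      by_cases ha : a = i
      · subst ha; simp
      · simp [ha]
    unfold minor
    rw [h, h, RingHom.id_apply, smul_eq_mul, ← Matrix.det_updateRow_smul]
    rfl

/-- A linear combination of minors, as a linear function of one row. -/
def rowForm (N : Matrix (Fin ℓ) (Fin m) F) (i : Fin ℓ) (k : Idx ℓ m → F) :
    (Fin m → F) →ₗ[F] F :=
  ∑ α, k α • rowMinor N i α

/-- The scalar `t` depends on `V` but not on the codeword `k`; this is what makes restriction to a
line a monomial equivalence. -/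
theorem exists_sum_minor_mat_eq (M : RepMatrices F ℓ m) {V : Grassmannian F ℓ m}
    {N : Matrix (Fin ℓ) (Fin m) F} {i : Fin ℓ} {x : Fin m → F}
    (hV : V.1 = spanOthers N i ⊔ Submodule.span F {x}) :
    ∃ t : F, t ≠ 0 ∧ ∀ k : Idx ℓ m → F,
      ∑ α, k α * minor α (M.mat V) = t * rowForm N i k x := by
  obtain ⟨t, ht, h⟩ := exists_minor_mat_eq M ((span_updateRow N i x).trans hV.symm)
  refine ⟨t, ht, fun k => ?_⟩
  simp only [rowForm, LinearMap.sum_apply, LinearMap.smul_apply, smul_eq_mul, Finset.mul_sum]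
  refine Finset.sum_congr rfl fun α _ => ?_
  rw [h]
  exact mul_left_comm _ _ _

/-- The function `g` agrees on each line contained in `X` with a codeword of the
Grassmann code. -/
def LinewiseCodeword (M : RepMatrices F ℓ m) (X : Set (Grassmannian F ℓ m))
    (g : Grassmannian F ℓ m → F) : Prop :=
  ∀ L ∈ linesIn X, ∃ k : Idx ℓ m → F, ∀ V ∈ L, g V = ∑ α, k α * minor α (M.mat V)

variable {M : RepMatrices F ℓ m} {X : Set (Grassmannian F ℓ m)} {g : Grassmannian F ℓ m → F}

/-- On the line joining `Z + ⟨x⟩` and `Z + ⟨y⟩`, `g` is a linear form up to nonzero scalars;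
vanishing at `x` and `y`, it vanishes at `x + y`. -/
theorem eq_zero_of_row_add (hg : LinewiseCodeword M X g) {N : Matrix (Fin ℓ) (Fin m) F}
    {i : Fin ℓ} {x y : Fin m → F}
    (hX : ∀ w ∈ Submodule.span F {x, y}, ∀ V : Grassmannian F ℓ m,
      V.1 = spanOthers N i ⊔ Submodule.span F {w} → V ∈ X)
    (hx : ∀ V : Grassmannian F ℓ m, V.1 = spanOthers N i ⊔ Submodule.span F {x} → g V = 0)
    (hy : ∀ V : Grassmannian F ℓ m, V.1 = spanOthers N i ⊔ Submodule.span F {y} → g V = 0)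
    (V : Grassmannian F ℓ m) (hV : V.1 = spanOthers N i ⊔ Submodule.span F {x + y}) :
    g V = 0 := by
  set Z := spanOthers N i with hZ
  have hlt : Module.finrank F Z < ℓ := finrank_spanOthers_lt N i
  have hxyZ : x + y ∉ Z := notMem_of_finrank_lt_sup (by rw [← hV, V.2]; exact hlt)
  have hZℓ : Module.finrank F Z + 1 = ℓ := by
    rw [← Submodule.finrank_sup_span_singleton hxyZ, ← hV, V.2]
  -- If `x` and `y` are dependent modulo `Z` there is no line, but `V` is then already one of the
  -- two given points.
  by_cases hxZ : x ∈ Z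
  · refine hy V (hV.trans (sup_span_singleton_eq one_ne_zero ?_))
    rwa [one_smul, add_sub_cancel_right]
  by_cases hyx : y ∈ Z ⊔ Submodule.span F {x}
  · obtain ⟨z, hz, w, hw, rfl⟩ := Submodule.mem_sup.1 hyx
    obtain ⟨c, rfl⟩ := Submodule.mem_span_singleton.1 hw
    have hc : 1 + c ≠ 0 := by
      intro hc
      apply hxyZ
      have : x + (z + c • x) = z + (1 + c) • x := by module
      rw [this, hc, zero_smul, add_zero]
      exact hz
    refine hx V (hV.trans (sup_span_singleton_eq hc ?_))
    have : x + (z + c • x) - (1 + c) • x = z := by module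
    rwa [this]
  have hyZ : y ∉ Z := fun h => hyx (Submodule.mem_sup_left h)
  have hspan : Z ⊔ Submodule.span F {x, y} =
      Z ⊔ Submodule.span F {x} ⊔ Submodule.span F {y} := by
    rw [Submodule.span_insert, sup_assoc]
  have hL : {V : Grassmannian F ℓ m | Z ≤ V.1 ∧ V.1 ≤ Z ⊔ Submodule.span F {x, y}} ∈
      linesIn X := by
    refine ⟨⟨Z, Z ⊔ Submodule.span F {x, y}, hZℓ, ?_, le_sup_left, rfl⟩, ?_⟩
    · rw [hspan, Submodule.finrank_sup_span_singleton hyx,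
        Submodule.finrank_sup_span_singleton hxZ, hZℓ]
    · rintro U ⟨hU, hU'⟩
      obtain ⟨w, hw, -, hUw⟩ := exists_eq_sup_span_singleton hU hU' (by rw [hZℓ, U.2])
      exact hX w hw U hUw
  obtain ⟨k, hk⟩ := hg _ hL
  have key : ∀ w ∈ Submodule.span F {x, y}, ∀ U : Grassmannian F ℓ m,
      U.1 = Z ⊔ Submodule.span F {w} → ∃ t : F, t ≠ 0 ∧ g U = t * rowForm N i k w := by
    intro w hw U hU
    obtain ⟨t, ht, h⟩ := exists_sum_minor_mat_eq M hU
    refine ⟨t, ht, ?_⟩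
    rw [← h]
    refine hk U ⟨hU ▸ le_sup_left, hU ▸ sup_le_sup_left ?_ _⟩
    exact (Submodule.span_singleton_le_iff_mem _ _).2 hw
  have hxm : x ∈ Submodule.span F {x, y} := Submodule.subset_span (by simp)
  have hym : y ∈ Submodule.span F {x, y} := Submodule.subset_span (by simp)
  have zero : ∀ w ∈ Submodule.span F {x, y}, w ∉ Z →
      (∀ U : Grassmannian F ℓ m, U.1 = Z ⊔ Submodule.span F {w} → g U = 0) →
      rowForm N i k w = 0 := by
    intro w hw hwZ h0
    obtain ⟨t, ht, h⟩ := key w hw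
      ⟨_, (Submodule.finrank_sup_span_singleton hwZ).trans hZℓ⟩ rfl
    rw [h0 _ rfl] at h
    exact (mul_eq_zero.1 h.symm).resolve_left ht
  obtain ⟨t, -, h⟩ := key (x + y) (Submodule.add_mem _ hxm hym) V hV
  rw [h, map_add, zero x hxm hxZ hx, zero y hym hyZ hy, add_zero, mul_zero]

theorem eq_zero_of_row_single (hg : LinewiseCodeword M X g) {α : Idx ℓ m}
    (hα : schubertVariety M α ⊆ X) {N : Matrix (Fin ℓ) (Fin m) F} {i : Fin ℓ}
    (hN : ∀ j k, α.1 j < k → N j k = 0)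
    (hs : ∀ k ≤ α.1 i, ∀ V : Grassmannian F ℓ m,
      V.1 = spanOthers N i ⊔ Submodule.span F {Pi.single k 1} → g V = 0)
    (V : Grassmannian F ℓ m) (hV : Submodule.span F (Set.range N.row) = V.1) : g V = 0 := by
  -- The support condition travels with the vanishing so that each line used in the summation lies
  -- in `Ω_α`, hence in `X`.
  let p : (Fin m → F) → Prop := fun x => (∀ k, α.1 i < k → x k = 0) ∧
    ∀ V : Grassmannian F ℓ m, V.1 = spanOthers N i ⊔ Submodule.span F {x} → g V = 0
  have hp0 : p 0 := by
    refine ⟨fun _ _ => rfl, fun V hV => ?_⟩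
    -- Vacuous: the other rows alone cannot span an `ℓ`-dimensional space.
    refine absurd (Submodule.zero_mem _) (notMem_of_finrank_lt_sup (Z := spanOthers N i)
      (x := (0 : Fin m → F)) ?_)
    rw [← hV, V.2]
    exact finrank_spanOthers_lt N i
  have hadd : ∀ x y, p x → p y → p (x + y) := by
    rintro x y ⟨hx, hx'⟩ ⟨hy, hy'⟩
    refine ⟨fun k hk => by simp [hx k hk, hy k hk], eq_zero_of_row_add hg ?_ hx' hy'⟩
    intro w hw U hU
    refine hα (mem_schubertVariety_of_row ((span_updateRow N i w).trans hU.symm) ?_)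
    intro j k hk
    by_cases hj : j = i
    · subst hj
      rw [Matrix.updateRow_self]
      obtain ⟨a, b, rfl⟩ := Submodule.mem_span_pair.1 hw
      simp [hx k hk, hy k hk]
    · rw [Matrix.updateRow_ne hj]
      exact hN j k hk
  have hsingle : ∀ k, p (Pi.single k (N i k)) := by
    intro k
    by_cases h0 : N i k = 0
    · rw [h0, Pi.single_zero]
      exact hp0
    · have hk : k ≤ α.1 i := by
        by_contra h
        exact h0 (hN i k (not_le.1 h))
      refine ⟨fun k' hk' => Pi.single_eq_of_ne (hk.trans_lt hk').ne' _, fun V hV => ?_⟩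
      refine hs k hk V (hV.trans (sup_span_singleton_eq h0 ?_))
      rw [← Pi.single_smul, smul_eq_mul, mul_one, sub_self]
      exact Submodule.zero_mem _
  have hpN : p (∑ k, Pi.single k (N i k)) :=
    Finset.sum_induction _ p hadd hp0 fun k _ => hsingle k
  rw [Finset.univ_sum_single] at hpN
  refine hpN.2 V ?_
  rw [← hV, ← span_updateRow, Matrix.updateRow_eq_self]

/-- The set `s` contains the rows not yet known to be unit vectors; each induction step replaces one
of them by unit vectors. -/
theorem eq_zero_of_rows_single (hg : LinewiseCodeword M X g) {α : Idx ℓ m}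
    (hα : schubertVariety M α ⊆ X)
    (h0 : ∀ β ≤ α, ∀ V : Grassmannian F ℓ m,
      V.1 = Submodule.span F (Set.range (coordMatrix F β).row) → g V = 0)
    (s : Finset (Fin ℓ)) : ∀ N : Matrix (Fin ℓ) (Fin m) F,
    (∀ j k, α.1 j < k → N j k = 0) → (∀ j ∉ s, ∃ k, N j = Pi.single k 1) →
    ∀ V : Grassmannian F ℓ m, Submodule.span F (Set.range N.row) = V.1 → g V = 0 := by
  induction s using Finset.induction_on with
  | empty =>
    intro N hN hs V hV
    choose f hf using fun j => hs j (Finset.notMem_empty j)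
    have hli := linearIndependent_row_of_span_eq hV
    have hinj : Function.Injective f := fun a b hab => hli.injective <| by
      change N a = N b
      rw [hf, hf, hab]
    obtain ⟨γ, σ, hγ⟩ := exists_sort hinj
    have hspan : V.1 = Submodule.span F (Set.range (coordMatrix F γ).row) := by
      rw [← hV, ← σ.surjective.range_comp (coordMatrix F γ).row]
      congr 1
      congr 1
      funext j
      exact (hf j).trans (by rw [hγ]; rfl)
    refine h0 γ ?_ V hspan
    -- The minor at `γ` is nonzero on this coordinate subspace, whereas the shape of `N` kills every
    -- minor not below `α`.
    by_contra hle
    have h1 : minor γ N = 0 := minor_eq_zero_of_not_le hN hle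
    obtain ⟨t, ht, h⟩ := exists_minor_mat_eq M
      (N := coordMatrix F γ) (W := V) hspan.symm
    obtain ⟨t', ht', h'⟩ := exists_minor_mat_eq M hV
    have h2 := h γ
    rw [h', h1, mul_zero] at h2
    rw [minor_coordMatrix_self, mul_one] at h2
    exact ht h2.symm
  | insert i s his ih =>
    intro N hN hs V hV
    refine eq_zero_of_row_single (i := i) hg hα hN (fun k hk U hU => ?_) V hV
    refine ih (N.updateRow i (Pi.single k 1)) ?_ ?_ U ((span_updateRow _ _ _).trans hU.symm)
    · intro j k' hk'
      by_cases hj : j = i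
      · subst hj
        rw [Matrix.updateRow_self]
        exact Pi.single_eq_of_ne (hk.trans_lt hk').ne' _
      · rw [Matrix.updateRow_ne hj]
        exact hN j k' hk'
    · intro j hj
      by_cases hji : j = i
      · subst hji
        exact ⟨k, Matrix.updateRow_self⟩
      · rw [Matrix.updateRow_ne hji]
        exact hs j (by simp [hj, hji])

/-- A linewise codeword on `X` that vanishes at the coordinate subspaces of a Schubert variety
contained in `X` vanishes on this Schubert variety. -/
theorem eq_zero_on_schubertVariety (hg : LinewiseCodeword M X g) {α : Idx ℓ m}
    (hα : schubertVariety M α ⊆ X)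
    (h0 : ∀ β ≤ α, ∀ V : Grassmannian F ℓ m,
      V.1 = Submodule.span F (Set.range (coordMatrix F β).row) → g V = 0)
    {V : Grassmannian F ℓ m} (hV : V ∈ schubertVariety M α) : g V = 0 := by
  obtain ⟨N, hN, hz⟩ := exists_row_of_mem_schubertVariety hV
  exact eq_zero_of_rows_single hg hα h0 Finset.univ N hz
    (fun j hj => absurd (Finset.mem_univ j) hj) V hN

end Generation

/-! ### The component code -/

section Component

variable {F : Type*} [Field F] (M' : RepMatrices F 1 2)

/-- The homogeneous coordinates of a point of the projective line. -/
def homCoord (P : Grassmannian F 1 2) : Fin 2 → F := M'.mat P 0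

theorem span_homCoord (P : Grassmannian F 1 2) : Submodule.span F {homCoord M' P} = P.1 := by
  rw [← M'.rowSpace_mat P]
  congr 1
  ext y
  simp only [Set.mem_singleton_iff, Set.mem_range]
  constructor
  · rintro rfl
    exact ⟨0, rfl⟩
  · rintro ⟨i, rfl⟩
    rw [Subsingleton.elim i 0]
    rfl

theorem homCoord_ne_zero (P : Grassmannian F 1 2) : homCoord M' P ≠ 0 := by
  intro h
  have h1 := span_homCoord M' P
  rw [h, Submodule.span_zero_singleton] at h1
  have h2 := P.2
  rw [← h1, finrank_bot] at h2
  exact zero_ne_one h2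

theorem exists_homCoord_eq_smul {v : Fin 2 → F} (hv : v ≠ 0) :
    ∃ (P : Grassmannian F 1 2) (c : F), c ≠ 0 ∧ homCoord M' P = c • v := by
  let P : Grassmannian F 1 2 := ⟨Submodule.span F {v}, finrank_span_singleton hv⟩
  have h : homCoord M' P ∈ Submodule.span F {v} := by
    change _ ∈ P.1
    rw [← span_homCoord M' P]
    exact Submodule.mem_span_singleton_self _
  obtain ⟨c, hc⟩ := Submodule.mem_span_singleton.1 h
  refine ⟨P, c, ?_, hc.symm⟩
  rintro rfl
  rw [zero_smul] at hc
  exact homCoord_ne_zero M' P hc.symm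

theorem eq_of_homCoord_eq_smul {P Q : Grassmannian F 1 2} {c : F}
    (h : homCoord M' P = c • homCoord M' Q) : P = Q := by
  have hc : c ≠ 0 := by
    rintro rfl
    rw [zero_smul] at h
    exact homCoord_ne_zero M' P h
  apply Subtype.ext
  rw [← span_homCoord M' P, ← span_homCoord M' Q, h]
  exact Submodule.span_singleton_smul_eq (isUnit_iff_ne_zero.2 hc) _

theorem eq_of_homCoord_det_eq_zero {P Q : Grassmannian F 1 2}
    (h : homCoord M' P 0 * homCoord M' Q 1 = homCoord M' P 1 * homCoord M' Q 0) : P = Q := by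
  by_cases h0 : homCoord M' Q 0 = 0
  · have h1 : homCoord M' Q 1 ≠ 0 := fun h1 => homCoord_ne_zero M' Q <| by
      ext i; fin_cases i <;> assumption
    rw [h0, mul_zero] at h
    have hP := (mul_eq_zero.1 h).resolve_right h1
    refine eq_of_homCoord_eq_smul M' (c := homCoord M' P 1 / homCoord M' Q 1) ?_
    ext i
    fin_cases i
    · simp [h0, hP]
    · simp [h1]
  · refine eq_of_homCoord_eq_smul M' (c := homCoord M' P 0 / homCoord M' Q 0) ?_
    ext i
    fin_cases i
    · simp [h0]
    · simp only [Pi.smul_apply, smul_eq_mul, Fin.mk_one]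
      field_simp
      exact h.symm

/-- A pair of coefficients, as a word indexed by the points of the projective line. -/
def linearForms : (Fin 2 → F) →ₗ[F] (Grassmannian F 1 2 → F) where
  toFun d P := d 0 * homCoord M' P 0 + d 1 * homCoord M' P 1
  map_add' d e := by
    ext P
    simp only [Pi.add_apply]
    ring
  map_smul' c d := by
    ext P
    simp only [Pi.smul_apply, smul_eq_mul, RingHom.id_apply]
    ring

theorem grassmannCode_one_two : grassmannCode M' = LinearMap.range (linearForms M') := by
  have hm : ∀ (α : Idx 1 2) P, minor α (M'.mat P) = homCoord M' P (α.1 0) := fun α P => by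
    rw [minor, Matrix.det_fin_one]
    rfl
  apply le_antisymm
  · refine Submodule.span_le.2 ?_
    rintro _ ⟨α, rfl⟩
    refine ⟨Pi.single (α.1 0) 1, ?_⟩
    ext P
    refine Eq.trans ?_ (hm α P).symm
    generalize α.1 0 = j
    fin_cases j <;> simp [linearForms]
  · rintro _ ⟨d, rfl⟩
    let idx : Fin 2 → Idx 1 2 := fun j => ⟨fun _ => j, Subsingleton.strictMono _⟩
    have : linearForms M' d = d 0 • (fun P => minor (idx 0) (M'.mat P)) +
        d 1 • (fun P => minor (idx 1) (M'.mat P)) := by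
      ext P
      simp only [Pi.add_apply, Pi.smul_apply, hm, smul_eq_mul]
      rfl
    rw [this]
    exact Submodule.add_mem _ (Submodule.smul_mem _ _ (Submodule.subset_span ⟨_, rfl⟩))
      (Submodule.smul_mem _ _ (Submodule.subset_span ⟨_, rfl⟩))

/-- Cramer's rule for two independent coordinate vectors. It yields both the dimension and the
minimum distance. -/
theorem linearForms_eq_zero {d : Fin 2 → F} {P Q : Grassmannian F 1 2} (hPQ : P ≠ Q)
    (hP : linearForms M' d P = 0) (hQ : linearForms M' d Q = 0) : d = 0 := by
  have hdet : homCoord M' P 0 * homCoord M' Q 1 - homCoord M' P 1 * homCoord M' Q 0 ≠ 0 :=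
    fun h => hPQ (eq_of_homCoord_det_eq_zero M' (sub_eq_zero.1 h))
  change d 0 * homCoord M' P 0 + d 1 * homCoord M' P 1 = 0 at hP
  change d 0 * homCoord M' Q 0 + d 1 * homCoord M' Q 1 = 0 at hQ
  refine funext (Fin.forall_fin_two.2 ⟨?_, ?_⟩)
  · refine (mul_eq_zero.1 ?_).resolve_right hdet
    linear_combination homCoord M' Q 1 * hP - homCoord M' P 1 * hQ
  · refine (mul_eq_zero.1 ?_).resolve_right hdet
    linear_combination homCoord M' P 0 * hQ - homCoord M' Q 0 * hP

/-- The affine coordinate of a point of the projective line. -/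
noncomputable def affineCoord (P : Grassmannian F 1 2) : Option F :=
  open Classical in
  if homCoord M' P 0 = 0 then none else some (homCoord M' P 1 / homCoord M' P 0)

theorem affineCoord_bijective : Function.Bijective (affineCoord M') := by
  constructor
  · intro P Q h
    apply eq_of_homCoord_det_eq_zero M'
    unfold affineCoord at h
    split_ifs at h with h1 h2 h2
    · rw [h1, h2, zero_mul, mul_zero]
    · have h := Option.some.inj h
      rw [div_eq_div_iff h1 h2] at h
      linear_combination -h
  · rintro (_ | x)
    · obtain ⟨P, c, -, h⟩ := exists_homCoord_eq_smul M' (v := ![0, 1])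
        (fun h => one_ne_zero (congrFun h 1))
      exact ⟨P, if_pos (by simp [h])⟩
    · obtain ⟨P, c, hc, h⟩ := exists_homCoord_eq_smul M' (v := ![1, x])
        (fun h => one_ne_zero (congrFun h 0))
      refine ⟨P, (if_neg (by simp [h, hc])).trans ?_⟩
      simp [h, hc]

/-- The projective line as `F ∪ {∞}`. -/
noncomputable def affineEquiv : Grassmannian F 1 2 ≃ Option F :=
  Equiv.ofBijective _ (affineCoord_bijective M')

theorem mem_doublyExtendedRS_two {c : Option F → F} :
    c ∈ doublyExtendedRS F 2 ↔
      ∃ d : Fin 2 → F, c none = d 1 ∧ ∀ x, c (some x) = d 0 + d 1 * x := by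
  constructor
  · rintro ⟨f, hf, rfl⟩
    refine ⟨fun i => f.coeff i, rfl, fun x => ?_⟩
    have hdeg : f.degree ≤ 1 := by
      have h : f.degree < (2 : ℕ) := Polynomial.mem_degreeLT.1 hf
      exact Order.lt_succ_iff.1 h
    change f.eval x = _
    conv_lhs => rw [Polynomial.eq_X_add_C_of_degree_le_one hdeg]
    simp
    ring
  · rintro ⟨d, h1, h2⟩
    refine ⟨Polynomial.C (d 1) * Polynomial.X + Polynomial.C (d 0), ?_, ?_⟩
    · refine Polynomial.mem_degreeLT.2 (Polynomial.degree_linear_le.trans_lt ?_)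
      exact Nat.cast_lt.2 one_lt_two
    · ext p
      cases p with
      | none =>
        rw [h1]
        change (Polynomial.C (d 1) * Polynomial.X + Polynomial.C (d 0)).coeff 1 = _
        simp [Polynomial.coeff_C]
      | some x =>
        rw [h2]
        change (Polynomial.C (d 1) * Polynomial.X + Polynomial.C (d 0)).eval x = _
        simp
        ring

theorem codeEquiv_doublyExtendedRS :
    CodeEquiv (grassmannCode M') (doublyExtendedRS F 2) := by
  classical
  -- Dividing by `s P` dehomogenises: a form becomes `d 0 + d 1 * x` at affine points and `d 1` at
  -- infinity.
  let s : Grassmannian F 1 2 → F := fun P =>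
    if homCoord M' P 0 = 0 then homCoord M' P 1 else homCoord M' P 0
  have hs : ∀ P, s P ≠ 0 := fun P h => by
    simp only [s] at h
    split_ifs at h with h0
    swap
    · exact h0 h
    exact homCoord_ne_zero M' P (by ext i; fin_cases i <;> assumption)
  have hform : ∀ (d : Fin 2 → F) P, linearForms M' d P = s P *
      (match affineEquiv M' P with | none => d 1 | some x => d 0 + d 1 * x) := fun d P => by
    change d 0 * homCoord M' P 0 + d 1 * homCoord M' P 1 = s P * (match affineCoord M' P with
      | none => d 1 | some x => d 0 + d 1 * x)
    by_cases h0 : homCoord M' P 0 = 0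
    · simp only [affineCoord, s, h0, if_true]
      ring
    · simp only [affineCoord, s, h0, if_false]
      field_simp
  refine ⟨affineEquiv M', fun j => (Units.mk0 _ (hs ((affineEquiv M').symm j)))⁻¹, fun c => ?_⟩
  simp only [Units.val_inv_eq_inv_val, Units.val_mk0]
  rw [grassmannCode_one_two, mem_doublyExtendedRS_two]
  constructor
  · rintro ⟨d, rfl⟩
    refine ⟨d, ?_, fun x => ?_⟩ <;>
    · rw [hform, inv_mul_cancel_left₀ (hs _), Equiv.apply_symm_apply]
  · rintro ⟨d, h1, h2⟩
    refine ⟨d, ?_⟩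
    ext P
    rw [hform]
    obtain ⟨j, rfl⟩ := (affineEquiv M').symm.surjective P
    rw [Equiv.apply_symm_apply]
    cases j with
    | none => rw [← h1, mul_inv_cancel_left₀ (hs _)]
    | some x =>
      change s _ * (d 0 + d 1 * x) = _
      rw [← h2, mul_inv_cancel_left₀ (hs _)]

theorem linearForms_injective : Function.Injective (linearForms M') := by
  rw [← LinearMap.ker_eq_bot, LinearMap.ker_eq_bot']
  intro d hd
  have hne : (affineEquiv M').symm none ≠ (affineEquiv M').symm (some 0) :=
    fun h => Option.some_ne_none _ ((affineEquiv M').symm.injective h).symm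
  exact linearForms_eq_zero M' hne (congrFun hd _) (congrFun hd _)

theorem finrank_grassmannCode_one_two : Module.finrank F (grassmannCode M') = 2 := by
  rw [grassmannCode_one_two, LinearMap.finrank_range_of_inj (linearForms_injective M'),
    Module.finrank_fin_fun]

variable [Finite F]

theorem card_grassmannian_one_two (M' : RepMatrices F 1 2) : Nat.card (Grassmannian F 1 2) = Nat.card F + 1 := by
  rw [Nat.card_congr (affineEquiv M'), Finite.card_option]

/-- A nonzero form has at most one zero among the `q + 1` points; the form with coefficients `![1,
0]` has exactly one, at infinity. -/
theorem hasMinDist_grassmannCode_one_two : HasMinDist (grassmannCode M') (Nat.card F) := by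
  have hcard := card_grassmannian_one_two M'
  have hsupp : ∀ c : Grassmannian F 1 2 → F,
      (Function.support c).ncard + (Function.support c)ᶜ.ncard = Nat.card F + 1 := fun c => by
    rw [Set.ncard_add_ncard_compl, hcard]
  rw [HasMinDist, grassmannCode_one_two]
  constructor
  · refine ⟨_, ⟨![1, 0], rfl⟩, ?_, ?_⟩
    · rw [Ne, LinearMap.map_eq_zero_iff _ (linearForms_injective M')]
      exact fun h => one_ne_zero (congrFun h 0)
    · have hz : (Function.support (linearForms M' ![1, 0]))ᶜ = {(affineEquiv M').symm none} := by
        ext P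
        rw [Set.mem_compl_iff, Function.notMem_support, Set.mem_singleton_iff,
          Equiv.eq_symm_apply]
        change _ ↔ affineCoord M' P = none
        simp [linearForms, affineCoord]
      have h := hsupp (linearForms M' ![1, 0])
      rw [hz, Set.ncard_singleton] at h
      omega
  · rintro w ⟨_, ⟨d, rfl⟩, hd, rfl⟩
    have h1 : (Function.support (linearForms M' d))ᶜ.ncard ≤ 1 := by
      rw [Set.ncard_le_one (Set.toFinite _)]
      intro P hP Q hQ
      by_contra hne
      apply hd
      rw [linearForms_eq_zero M' hne (Function.notMem_support.1 hP)
        (Function.notMem_support.1 hQ), map_zero]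
    have h := hsupp (linearForms M' d)
    omega

end Component

/-! ### Lines and projections of the Grassmann code -/

section Lines

variable {F : Type*} [Field F] {ℓ m : ℕ}

theorem exists_spanOthers_eq {Z : Submodule F (Fin m → F)} (hZ : Module.finrank F Z + 1 = ℓ) :
    ∃ (N : Matrix (Fin ℓ) (Fin m) F) (i : Fin ℓ), spanOthers N i = Z := by
  subst hZ
  let b := Module.finBasis F Z
  refine ⟨Matrix.of (Fin.cons 0 fun j => (b j : Fin m → F)), 0, ?_⟩
  have h : Submodule.span F (Set.range fun j => (b j : Fin m → F)) = Z := by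
    have h2 := congrArg (Submodule.map Z.subtype) b.span_eq
    rwa [Submodule.map_span, Submodule.map_subtype_top, ← Set.range_comp] at h2
  conv_rhs => rw [← h]
  rw [spanOthers, ← Fin.range_succ, ← Set.range_comp]
  rfl

/-- Otherwise a nonzero functional `e` annihilates all pairs of values, so every minor vanishes once
row `i` is `e 0 • x + e 1 • y`; yet those rows are independent. Hence restriction to a line gives
all linear forms. -/
theorem exists_rowForm_eq {N : Matrix (Fin ℓ) (Fin m) F} {i : Fin ℓ} {x y : Fin m → F}
    (hℓ : Module.finrank F (spanOthers N i) + 1 = ℓ)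
    (hxy : ∀ d : Fin 2 → F, d 0 • x + d 1 • y ∈ spanOthers N i → d = 0) (d : Fin 2 → F) :
    ∃ k : Idx ℓ m → F, rowForm N i k x = d 0 ∧ rowForm N i k y = d 1 := by
  let v : Idx ℓ m → Fin 2 → F := fun α => ![rowMinor N i α x, rowMinor N i α y]
  have htop : Submodule.span F (Set.range v) = ⊤ := by
    by_contra hne
    obtain ⟨f, hf, hle⟩ := Submodule.exists_le_ker_of_lt_top _ (lt_top_iff_ne_top.2 hne)
    have hfe : ∀ d : Fin 2 → F, f d = f (Pi.single 0 1) * d 0 + f (Pi.single 1 1) * d 1 := by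
      intro d
      have : d = d 0 • Pi.single 0 1 + d 1 • Pi.single 1 1 := by
        refine funext (Fin.forall_fin_two.2 ⟨?_, ?_⟩) <;> simp
      conv_lhs => rw [this]
      rw [map_add, map_smul, map_smul, smul_eq_mul, smul_eq_mul, mul_comm, mul_comm (d 1)]
    let e : Fin 2 → F := ![f (Pi.single 0 1), f (Pi.single 1 1)]
    have he : e ≠ 0 := by
      intro h
      have h0 : f (Pi.single 0 1) = 0 := congrFun h 0
      have h1 : f (Pi.single 1 1) = 0 := congrFun h 1
      exact hf (LinearMap.ext fun d => by
        rw [hfe, h0, h1, zero_mul, zero_mul, add_zero, LinearMap.zero_apply])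
    have hw : e 0 • x + e 1 • y ∉ spanOthers N i := fun h => he (hxy e h)
    have hli : LinearIndependent F (N.updateRow i (e 0 • x + e 1 • y)).row := by
      rw [linearIndependent_row_iff_finrank, span_updateRow,
        Submodule.finrank_sup_span_singleton hw, hℓ]
    obtain ⟨α, hα⟩ := exists_minor_ne_zero hli
    apply hα
    change rowMinor N i α (e 0 • x + e 1 • y) = 0
    have h := hle (Submodule.subset_span ⟨α, rfl⟩)
    rw [LinearMap.mem_ker, hfe] at h
    rw [map_add, map_smul, map_smul]
    exact h
  obtain ⟨k, hk⟩ := (Submodule.mem_span_range_iff_exists_fun F).1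
    (htop ▸ Submodule.mem_top : d ∈ Submodule.span F (Set.range v))
  refine ⟨k, ?_, ?_⟩ <;>
  · rw [← hk]
    simp [rowForm, v, LinearMap.sum_apply]

/-- Each line of the Grassmannian is a projective line, in such a way that the restrictions of the
codewords of the Grassmann code are, up to nonzero scalars, the linear forms. -/
theorem IsLine.exists_equiv (M : RepMatrices F ℓ m) (M' : RepMatrices F 1 2)
    {L : Set (Grassmannian F ℓ m)} (hL : IsLine L) :
    ∃ (e : Grassmannian F 1 2 ≃ L) (t : Grassmannian F 1 2 → Fˣ),
      (∀ k : Idx ℓ m → F, ∃ d, ∀ P,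
        ∑ α, k α * minor α (M.mat (e P).1) = t P * linearForms M' d P) ∧
      ∀ d, ∃ k : Idx ℓ m → F, ∀ P,
        ∑ α, k α * minor α (M.mat (e P).1) = t P * linearForms M' d P := by
  obtain ⟨Z, Z', hZ, hZ', hZZ', rfl⟩ := hL
  obtain ⟨x, hxZ', hxZ⟩ := Set.exists_of_ssubset
    (lt_of_le_of_ne hZZ' (by rintro rfl; omega) : Z < Z')
  have hr1 := Submodule.finrank_sup_span_singleton hxZ
  have hle1 : Z ⊔ Submodule.span F {x} ≤ Z' :=
    sup_le hZZ' ((Submodule.span_singleton_le_iff_mem _ _).2 hxZ')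
  obtain ⟨y, hyZ', hy⟩ := Set.exists_of_ssubset
    (lt_of_le_of_ne hle1 (by intro h; rw [h] at hr1; omega) : Z ⊔ Submodule.span F {x} < Z')
  have hZ'eq : Z' = Z ⊔ Submodule.span F {x, y} := by
    rw [Submodule.span_insert, ← sup_assoc]
    exact eq_sup_span_singleton hle1 (by omega) hyZ' hy
  -- `f` identifies `F ^ 2` with a complement of `Z` in `Z'`, so points of the projective line
  -- become points of the given line.
  let f : (Fin 2 → F) → (Fin m → F) := fun d => d 0 • x + d 1 • y
  have hf : ∀ d, f d ∈ Z → d = 0 := by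
    intro d hd
    have h1 : d 1 = 0 := by
      by_contra h1
      apply hy
      have : y = (d 1)⁻¹ • (f d) + (-(d 1)⁻¹ * d 0) • x := by
        simp only [f, smul_add, smul_smul, inv_mul_cancel₀ h1, one_smul]
        module
      rw [this]
      exact Submodule.add_mem _ (Submodule.mem_sup_left (Z.smul_mem _ hd))
        (Submodule.mem_sup_right (Submodule.smul_mem _ _ (Submodule.mem_span_singleton_self x)))
    have h0 : d 0 = 0 := by
      by_contra h0
      apply hxZ
      have : x = (d 0)⁻¹ • (f d) := by
        simp only [f, h1, zero_smul, add_zero, smul_smul, inv_mul_cancel₀ h0, one_smul]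
      rw [this]
      exact Z.smul_mem _ hd
    exact funext (Fin.forall_fin_two.2 ⟨h0, h1⟩)
  have hP : ∀ P, f (homCoord M' P) ∉ Z := fun P h => homCoord_ne_zero M' P (hf _ h)
  have hfspan : ∀ d, f d ∈ Submodule.span F {x, y} := fun d =>
    Submodule.mem_span_pair.2 ⟨_, _, rfl⟩
  let E : Grassmannian F 1 2 → {V : Grassmannian F ℓ m | Z ≤ V.1 ∧ V.1 ≤ Z'} := fun P =>
    ⟨⟨Z ⊔ Submodule.span F {f (homCoord M' P)},
      (Submodule.finrank_sup_span_singleton (hP P)).trans hZ⟩, le_sup_left, by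
      rw [hZ'eq]
      exact sup_le_sup_left ((Submodule.span_singleton_le_iff_mem _ _).2 (hfspan _)) _⟩
  have hE : Function.Bijective E := by
    constructor
    · intro P Q hPQ
      have h : Z ⊔ Submodule.span F {f (homCoord M' P)} =
        Z ⊔ Submodule.span F {f (homCoord M' Q)} :=
        congrArg (fun V : {V : Grassmannian F ℓ m | Z ≤ V.1 ∧ V.1 ≤ Z'} => V.1.1) hPQ
      have hm : f (homCoord M' P) ∈ Z ⊔ Submodule.span F {f (homCoord M' Q)} := by
        rw [← h]
        exact Submodule.mem_sup_right (Submodule.mem_span_singleton_self _)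
      obtain ⟨z, hz, w, hw, hzw⟩ := Submodule.mem_sup.1 hm
      obtain ⟨c, rfl⟩ := Submodule.mem_span_singleton.1 hw
      have hd : f (homCoord M' P - c • homCoord M' Q) ∈ Z := by
        have : f (homCoord M' P - c • homCoord M' Q) = z := by
          rw [eq_sub_of_add_eq hzw]
          simp only [f, Pi.sub_apply, Pi.smul_apply, smul_eq_mul]
          module
        rwa [this]
      exact eq_of_homCoord_eq_smul M' (sub_eq_zero.1 (hf _ hd))
    · rintro ⟨V, hV, hV'⟩
      rw [hZ'eq] at hV'
      obtain ⟨w, hw, hwZ, hVw⟩ := exists_eq_sup_span_singleton hV hV' (by rw [hZ, V.2])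
      obtain ⟨a, b, rfl⟩ := Submodule.mem_span_pair.1 hw
      have hab : (![a, b] : Fin 2 → F) ≠ 0 := by
        intro h
        have ha : a = 0 := congrFun h 0
        have hb : b = 0 := congrFun h 1
        exact hwZ (by simp [ha, hb])
      obtain ⟨P, c, hc, hPc⟩ := exists_homCoord_eq_smul M' hab
      refine ⟨P, Subtype.ext (Subtype.ext ?_)⟩
      change Z ⊔ Submodule.span F {f (homCoord M' P)} = V.1
      rw [hVw]
      refine sup_span_singleton_eq hc ?_
      have : f (homCoord M' P) - c • (a • x + b • y) = 0 := by
        rw [hPc]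
        simp only [f, Pi.smul_apply, smul_eq_mul, Matrix.cons_val_zero, Matrix.cons_val_one]
        module
      rw [this]
      exact Z.zero_mem
  obtain ⟨N, i, rfl⟩ := exists_spanOthers_eq hZ
  choose t ht h using fun P => exists_sum_minor_mat_eq M (V := (E P).1) (N := N) (i := i)
    (x := f (homCoord M' P)) rfl
  have hform : ∀ k P, rowForm N i k (f (homCoord M' P)) =
      linearForms M' ![rowForm N i k x, rowForm N i k y] P := fun k P => by
    simp only [f, map_add, map_smul, smul_eq_mul]
    rw [mul_comm, mul_comm (homCoord M' P 1)]
    rfl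
  refine ⟨Equiv.ofBijective E hE, fun P => Units.mk0 _ (ht P), fun k => ?_,
    fun d => ?_⟩
  · exact ⟨![rowForm N i k x, rowForm N i k y], fun P => (h P k).trans (congrArg (t P * ·) (hform k P))⟩
  · obtain ⟨k, hk0, hk1⟩ := exists_rowForm_eq hZ hf d
    refine ⟨k, fun P => (h P k).trans (congrArg (t P * ·) ((hform k P).trans ?_))⟩
    rw [hk0, hk1]
    congr

/-! ### Membership in the codes, transport and equivalence. -/

theorem mem_schubertUnionCode {M : RepMatrices F ℓ m} {S : Set (Idx ℓ m)}
    {c : schubertUnion M S → F} :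
    c ∈ schubertUnionCode M S ↔
      ∃ k : Idx ℓ m → F, ∀ v, c v = ∑ α, k α * minor α (M.mat v.1) := by
  constructor
  · rintro ⟨f, hf, rfl⟩
    obtain ⟨k, rfl⟩ := (Submodule.mem_span_range_iff_exists_fun F).1 hf
    refine ⟨k, fun v => ?_⟩
    simp [LinearMap.funLeft_apply]
  · rintro ⟨k, hk⟩
    refine ⟨∑ α, k α • fun W => minor α (M.mat W),
      (Submodule.mem_span_range_iff_exists_fun F).2 ⟨k, rfl⟩, ?_⟩
    ext v
    simp [LinearMap.funLeft_apply, hk]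

theorem mem_proj_schubertUnionCode {M : RepMatrices F ℓ m} {S : Set (Idx ℓ m)}
    {B : Set (schubertUnion M S)} {c : B → F} :
    c ∈ proj (schubertUnionCode M S) B ↔
      ∃ k : Idx ℓ m → F, ∀ v, c v = ∑ α, k α * minor α (M.mat v.1.1) := by
  constructor
  · rintro ⟨f, hf, rfl⟩
    obtain ⟨k, hk⟩ := mem_schubertUnionCode.1 hf
    exact ⟨k, fun v => hk v.1⟩
  · rintro ⟨k, hk⟩
    refine ⟨fun v => ∑ α, k α * minor α (M.mat v.1), mem_schubertUnionCode.2 ⟨k, fun _ => rfl⟩, ?_⟩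
    ext v
    exact (hk v).symm

theorem mem_transport {B B' : Type*} {φ : B ≃ B'} {C : Submodule F (B → F)} {c : B' → F} :
    c ∈ transport φ C ↔ c ∘ φ ∈ C := by
  constructor
  · rintro ⟨f, hf, rfl⟩
    have h : LinearMap.funLeft F F φ.symm f ∘ φ = f := by
      ext b
      simp [LinearMap.funLeft_apply]
    rwa [h]
  · intro h
    refine ⟨_, h, ?_⟩
    ext b
    simp [LinearMap.funLeft_apply]

theorem transport_symm_transport {B B' : Type*} (φ : B ≃ B') (C : Submodule F (B → F)) :
    transport φ.symm (transport φ C) = C := by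
  ext c
  rw [mem_transport, mem_transport]
  simp [Function.comp_assoc]

theorem finrank_transport {B B' : Type*} (φ : B ≃ B') (C : Submodule F (B → F)) :
    Module.finrank F (transport φ C) = Module.finrank F C :=
  LinearEquiv.finrank_map_eq (LinearEquiv.funCongrLeft F F φ.symm) C

theorem CodeEquiv.finrank_eq {A A' : Type*} {C : Submodule F (A → F)} {C' : Submodule F (A' → F)}
    (h : CodeEquiv C C') : Module.finrank F C = Module.finrank F C' := by
  obtain ⟨σ, a, h⟩ := h
  let Θ : (A → F) ≃ₗ[F] (A' → F) := (LinearEquiv.funCongrLeft F F σ.symm).trans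
    (LinearEquiv.piCongrRight fun j => LinearEquiv.smulOfUnit (a j))
  have hC : C' = C.map Θ.toLinearMap := by
    ext c
    rw [← Θ.apply_symm_apply c]
    have := (h (Θ.symm c)).symm
    rw [Submodule.mem_map_equiv, LinearEquiv.apply_symm_apply]
    rw [← this]
    have h2 : (fun j => (a j : F) * Θ.symm c (σ.symm j)) = Θ (Θ.symm c) := rfl
    rw [h2, LinearEquiv.apply_symm_apply]
  rw [hC]
  exact (LinearEquiv.finrank_map_eq Θ C).symm

/-! ### Schubert union codes as Tanner codes. -/

variable (M : RepMatrices F ℓ m) (S : Set (Idx ℓ m))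

/-- The neighborhood of a line in the incidence graph consists of the points of the line. -/
def nbhdEquiv (u : linesIn (schubertUnion M S)) :
    (incidenceGraph (schubertUnion M S)).nbhd u ≃ u.1 where
  toFun v := ⟨v.1.1, v.2⟩
  invFun v := ⟨⟨v.1, u.2.2 v.2⟩, v.2⟩
  left_inv _ := rfl
  right_inv _ := rfl

theorem exists_codeEquiv_nbhd (M' : RepMatrices F 1 2) (u : linesIn (schubertUnion M S)) :
    ∃ φ : (incidenceGraph (schubertUnion M S)).nbhd u ≃ Grassmannian F 1 2,
      CodeEquiv (transport φ (proj (schubertUnionCode M S)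
        ((incidenceGraph (schubertUnion M S)).nbhd u))) (grassmannCode M') := by
  obtain ⟨e, t, h1, h2⟩ := u.2.1.exists_equiv M M'
  let φ := (nbhdEquiv M S u).trans e.symm
  have hφ : ∀ P, (φ.symm P).1.1 = (e P).1 := fun P => rfl
  refine ⟨φ, Equiv.refl _, fun P => (t P)⁻¹, fun c => ?_⟩
  rw [mem_transport, mem_proj_schubertUnionCode, grassmannCode_one_two]
  have hrw : ∀ k : Idx ℓ m → F,
      (∀ v, (c ∘ φ) v = ∑ α, k α * minor α (M.mat v.1.1)) ↔
      ∀ P, c P = ∑ α, k α * minor α (M.mat (e P).1) := fun k => by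
    rw [← φ.symm.forall_congr_right]
    simp only [Function.comp_apply, Equiv.apply_symm_apply, hφ]
  simp only [hrw]
  constructor
  · rintro ⟨k, hk⟩
    obtain ⟨d, hd⟩ := h1 k
    refine ⟨d, ?_⟩
    ext P
    change _ = ((t P)⁻¹ : Fˣ) * c P
    rw [hk, hd, Units.inv_mul_cancel_left]
  · rintro ⟨d, hd⟩
    obtain ⟨k, hk⟩ := h2 d
    refine ⟨k, fun P => ?_⟩
    rw [hk, hd]
    exact (Units.mul_inv_cancel_left (t P) (c P)).symm

theorem isTannerCode_schubertUnionCode [Finite F] (M' : RepMatrices F 1 2) :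
    IsTannerCode (incidenceGraph (schubertUnion M S)) (grassmannCode M')
      (schubertUnionCode M S) := by
  choose φ hφ using exists_codeEquiv_nbhd M S M'
  -- The local codes are taken to be the transported projections themselves.
  refine ⟨fun u => ⟨Set.toFinite _, ?_⟩, φ, _, fun u => ⟨hφ u, le_rfl⟩⟩
  rw [← Nat.card_coe_set_eq, Nat.card_congr (φ u)]

variable {M S}

/-- The codes that present the Schubert union code as a Tanner code are its projections. -/
theorem transport_proj_eq_of_isTannerCodeFor [Finite F] {M' : RepMatrices F 1 2}
    {φ : ∀ u, (incidenceGraph (schubertUnion M S)).nbhd u ≃ Grassmannian F 1 2}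
    {D : linesIn (schubertUnion M S) → Submodule F (Grassmannian F 1 2 → F)}
    (h : IsTannerCodeFor (incidenceGraph (schubertUnion M S)) (grassmannCode M') φ D
      (schubertUnionCode M S)) (u : linesIn (schubertUnion M S)) :
    transport (φ u) (proj (schubertUnionCode M S)
      ((incidenceGraph (schubertUnion M S)).nbhd u)) = D u := by
  obtain ⟨φ', h'⟩ := exists_codeEquiv_nbhd M S M' u
  -- Both sides have the dimension of the component code, so the inclusion is an equality.
  refine Submodule.eq_of_le_of_finrank_eq (h u).2 ?_
  rw [(h u).1.finrank_eq, ← h'.finrank_eq, finrank_transport, finrank_transport]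

/-- A word on a Schubert union whose projections on all lines are projections of codewords is a
codeword. -/
theorem mem_schubertUnionCode_of_proj {f : schubertUnion M S → F}
    (hf : ∀ u : linesIn (schubertUnion M S),
      LinearMap.funLeft F F (Subtype.val :
        (incidenceGraph (schubertUnion M S)).nbhd u → schubertUnion M S) f ∈
      proj (schubertUnionCode M S) ((incidenceGraph (schubertUnion M S)).nbhd u)) :
    f ∈ schubertUnionCode M S := by
  classical
  let g₀ : Grassmannian F ℓ m → F := fun W => if h : W ∈ schubertUnion M S then f ⟨W, h⟩ else 0
  have hg₀ : ∀ v : schubertUnion M S, g₀ v.1 = f v := fun v => dif_pos v.2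
  let E : Idx ℓ m → Grassmannian F ℓ m := fun α =>
    ⟨Submodule.span F (Set.range (coordMatrix F α).row),
      (linearIndependent_row_iff_finrank _).1 (linearIndependent_coordMatrix α)⟩
  choose t ht hE using fun α => exists_minor_mat_eq M (W := E α) (N := coordMatrix F α) rfl
  -- Interpolation at the coordinate subspaces; for those outside `Ω_S` the default value of `g₀`
  -- makes the coefficient zero.
  let k : Idx ℓ m → F := fun α => g₀ (E α) / t α
  let g : Grassmannian F ℓ m → F := fun W => g₀ W - ∑ α, k α * minor α (M.mat W)
  have hgE : ∀ α, g (E α) = 0 := fun α => by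
    simp only [g, hE]
    rw [Finset.sum_eq_single α]
    · rw [minor_coordMatrix_self, mul_one, div_mul_cancel₀ _ (ht α), sub_self]
    · intro β _ hβ
      rw [minor_coordMatrix_of_ne hβ, mul_zero, mul_zero]
    · exact fun h => absurd (Finset.mem_univ _) h
  have hg : LinewiseCodeword M (schubertUnion M S) g := by
    intro L hL
    obtain ⟨k', hk'⟩ := mem_proj_schubertUnionCode.1 (hf ⟨L, hL⟩)
    refine ⟨k' - k, fun V hV => ?_⟩
    have h := hk' ⟨⟨V, hL.2 hV⟩, hV⟩
    rw [LinearMap.funLeft_apply, ← hg₀] at h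
    simp only [g, Pi.sub_apply, sub_mul, Finset.sum_sub_distrib]
    rw [h]
  refine mem_schubertUnionCode.2 ⟨k, fun v => ?_⟩
  obtain ⟨α, hα, hv⟩ := Set.mem_iUnion₂.1 v.2
  have h0 : g v.1 = 0 := by
    refine eq_zero_on_schubertVariety hg
      (Set.subset_biUnion_of_mem (u := schubertVariety M) hα) (fun β _ V hV => ?_) hv
    rw [show V = E β from Subtype.ext hV]
    exact hgE β
  rw [← hg₀]
  exact sub_eq_zero.1 h0

/-! ### Duality and the maximal Tanner code. -/

/-- A functional separating `c` from `C` is the pairing with its vector of values on unit vectors,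
which lies in the dual code. -/
theorem dualCode_dualCode_le {A : Type*} [Finite A] (C : Submodule F (A → F)) :
    dualCode (dualCode C) ≤ C := by
  classical
  have := Fintype.ofFinite A
  intro c hc
  by_contra hcC
  obtain ⟨f, hf, hle⟩ := Submodule.exists_le_ker_of_notMem hcC
  have hfe : ∀ x : A → F, f x = ∑ a, x a * f (Pi.single a 1) := fun x => by
    conv_lhs => rw [← Finset.univ_sum_single x]
    rw [map_sum]
    refine Finset.sum_congr rfl fun a _ => ?_
    rw [← smul_eq_mul, ← map_smul, ← Pi.single_smul, smul_eq_mul, mul_one]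
  apply hf
  have hmem : (fun a => f (Pi.single a 1)) ∈ dualCode C := by
    intro x hx
    rw [finsum_eq_sum_of_fintype, ← hfe]
    exact hle hx
  have h := hc _ hmem
  rw [finsum_eq_sum_of_fintype] at h
  rw [hfe, ← h]
  exact Finset.sum_congr rfl fun a _ => mul_comm _ _

theorem finsum_subtype_mul_eq {V₁ : Type*} {B : Set V₁} {c d : V₁ → F}
    (hd : Function.support d ⊆ B) : ∑ᶠ b : B, c b * d b = ∑ᶠ v, c v * d v := by
  rw [finsum_set_coe_eq_finsum_mem (f := fun v => c v * d v)]
  refine finsum_congr fun v => ?_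
  by_cases hv : v ∈ B
  · simp [hv]
  · simp [hv, Function.notMem_support.1 fun h => hv (hd h)]

theorem le_maximalTannerCode {V₁ V₂ N : Type*} [Finite V₁] {G : BipartiteGraph V₁ V₂}
    {C' : Submodule F (N → F)} {φ : ∀ u : V₂, G.nbhd u ≃ N} {D : V₂ → Submodule F (N → F)}
    {C : Submodule F (V₁ → F)} (h : IsTannerCodeFor G C' φ D C) :
    C ≤ maximalTannerCode G φ D := by
  have hle : ⨆ u, localChecks G φ D u ≤ dualCode C := by
    refine iSup_le fun u d hd c hc => ?_
    rw [← finsum_subtype_mul_eq hd.1]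
    refine hd.2 (fun b => c b) (mem_transport.2 ((h u).2 ⟨_, ⟨c, hc, rfl⟩, ?_⟩))
    ext j
    rfl
  intro c hc d hd
  rw [← hle hd c hc]
  exact finsum_congr fun v => mul_comm _ _

theorem proj_mem_of_mem_maximalTannerCode {V₁ V₂ N : Type*} [Finite V₁] {G : BipartiteGraph V₁ V₂}
    {φ : ∀ u : V₂, G.nbhd u ≃ N} {D : V₂ → Submodule F (N → F)}
    {c : V₁ → F} (hc : c ∈ maximalTannerCode G φ D) (u : V₂) :
    LinearMap.funLeft F F (Subtype.val : G.nbhd u → V₁) c ∈ transport (φ u).symm (D u) := by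
  refine dualCode_dualCode_le _ fun e he => ?_
  -- Extension by zero turns a dual word of the local code into a global parity check at `u`.
  let d : V₁ → F := Function.extend Subtype.val e 0
  have hd : ∀ b : G.nbhd u, d b = e b := fun b => Subtype.val_injective.extend_apply e 0 b
  have hsupp : Function.support d ⊆ G.nbhd u := fun v hv => by
    by_contra h
    exact hv (Function.extend_apply' _ _ _ fun ⟨b, hb⟩ => h (hb ▸ b.2))
  have hde : LinearMap.funLeft F F (Subtype.val : G.nbhd u → V₁) d = e := funext hd
  have h := hc d (Submodule.mem_iSup_of_mem u ⟨hsupp, hde.symm ▸ he⟩)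
  simp only [mul_comm (d _)] at h
  rw [← finsum_subtype_mul_eq hsupp] at h
  rw [← h]
  refine finsum_congr fun b => ?_
  rw [hd, mul_comm]
  rfl

end Lines

end TannerSchubert

theorem mainTheorem1 {F : Type*} [Field F] [Finite F] {ℓ m : ℕ} (hℓ : 1 ≤ ℓ) (hℓm : ℓ ≤ m)
    (M : RepMatrices F ℓ m) (M' : RepMatrices F 1 2)
    (S : Set (Idx ℓ m)) (hS : IsLowerSet S) :
    -- the component code is the `[q + 1, 2, q]` doubly extended Reed-Solomon code
    (CodeEquiv (grassmannCode M')
        (doublyExtendedRS F 2) ∧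
      Nat.card (Grassmannian F 1 2) = Nat.card F + 1 ∧
      Module.finrank F (grassmannCode M') = 2 ∧
      HasMinDist (grassmannCode M') (Nat.card F)) ∧
    -- the Schubert union code is a Tanner code on the incidence graph of the Schubert union
    IsTannerCode
      (incidenceGraph (schubertUnion M S))
      (grassmannCode M') (schubertUnionCode M S) ∧
    -- every such Tanner code that contains the Schubert union code is equal to it
    (∀ C : Submodule F (schubertUnion M S → F),
      IsTannerCode
        (incidenceGraph (schubertUnion M S))
        (grassmannCode M') C →
      schubertUnionCode M S ≤ C →
      schubertUnionCode M S = C) ∧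
    -- the Schubert union code is the maximal Tanner code for all data that present it as one
    (∀ (φ : ∀ u, (incidenceGraph (schubertUnion M S)).nbhd u ≃
          Grassmannian F 1 2)
        (D : linesIn (schubertUnion M S) →
          Submodule F (Grassmannian F 1 2 → F)),
      IsTannerCodeFor
        (incidenceGraph (schubertUnion M S))
        (grassmannCode M') φ D (schubertUnionCode M S) →
      schubertUnionCode M S =
        maximalTannerCode
          (incidenceGraph (schubertUnion M S)) φ D) := by
  refine ⟨⟨codeEquiv_doublyExtendedRS M', card_grassmannian_one_two M',
    finrank_grassmannCode_one_two M', hasMinDist_grassmannCode_one_two M'⟩,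
    isTannerCode_schubertUnionCode M S M', ?_, ?_⟩
  · rintro C ⟨-, φ, D, hC⟩ hle
    -- The data presenting `C` also present the subcode, whose projections fill each `D u`; so the
    -- projections of `C` are projections of the subcode.
    have hSC : IsTannerCodeFor (incidenceGraph (schubertUnion M S)) (grassmannCode M') φ D
        (schubertUnionCode M S) := fun u =>
      ⟨(hC u).1, (Submodule.map_mono (Submodule.map_mono hle)).trans (hC u).2⟩
    refine le_antisymm hle fun f hf => mem_schubertUnionCode_of_proj fun u => ?_
    rw [← transport_symm_transport (φ u) (proj (schubertUnionCode M S) _),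
      transport_proj_eq_of_isTannerCodeFor hSC u, mem_transport]
    exact (hC u).2 ⟨_, ⟨f, hf, rfl⟩, rfl⟩
  · intro φ D h
    refine le_antisymm (le_maximalTannerCode h)
      fun f hf => mem_schubertUnionCode_of_proj fun u => ?_
    rw [← transport_symm_transport (φ u) (proj (schubertUnionCode M S) _),
      transport_proj_eq_of_isTannerCodeFor h u]
    exact proj_mem_of_mem_maximalTannerCode hf u
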